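/- Let $E$ be a Hilbert $C^*$-module over a (not necessarily unital) $C^*$-algebra $A$. Let $L(E)$ be the algebra of bounded adjointable operators on $E$, and let $K(E)\subseteq L(E)$ be the ideal of compact operators, i.e. the norm-closed linear span of the operators $\theta_{x,y}\colon z\mapsto x\langle y,z\rangle$ ($x,y\in E$). A closed densely defined $A$-linear operator $t\colon D(t)\subseteq E\to E$ with densely defined adjoint $t^*$ is called regular if $I+t^*t$ has dense range, and a regular operator is called selfadjoint if $t=t^*$. A regular operator $t$ is called Fredholm if there are $G,G'\in L(E)$ such that $Gt$ and $tG'$ are closable, their closures $\overline{Gt}$ and $\overline{tG'}$ belong to $L(E)$, and $\overline{Gt}-I\in K(E)$, $\overline{tG'}-I\in K(E)$. An operator $T\in L(E)$ is called Fredholm if it is invertible modulo $K(E)$, i.e. if there is $G\in L(E)$ with $GT-I\in K(E)$ and $TG-I\in K(E)$. Let $t$ be a selfadjoint regular operator on $E$. Then $t+i\colon D(t)\to E$ is bijective, the Cayley transform $C_t=(t-i)(t+i)^{-1}$ is an everywhere defined bounded adjointable operator on $E$, and $t$ is Fredholm if and only if $I+C_t$ is Fredholm. -/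

import Mathlib

/-! Hilbert C⋆-modules are Mathlib's `CStarModule`s that are complete.  Mathlib's convention is that
the inner product is linear in its second variable and `⟪x, a • y⟫ = a * ⟪x, y⟫`; the coefficient
algebra `A` need not be unital. Unbounded operators are partially defined ℂ-linear maps
`E →ₗ.[ℂ] E`. -/

namespace HilbertModule

open CStarModule

noncomputable section

set_option linter.unusedSectionVars false

/-! ### Composition of partially defined linear maps -/

section Comp

variable {E F G : Type*} [AddCommGroup E] [Module ℂ E] [AddCommGroup F] [Module ℂ F]
  [AddCommGroup G] [Module ℂ G]

/-- The composition `g f` of unbounded operators, with domain `{x ∈ D(f) | f x ∈ D(g)}`. -/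
def pcomp (g : F →ₗ.[ℂ] G) (f : E →ₗ.[ℂ] F) : E →ₗ.[ℂ] G where
  domain :=
    { carrier := {x | ∃ h : x ∈ f.domain, f ⟨x, h⟩ ∈ g.domain}
      zero_mem' := ⟨f.domain.zero_mem, by
        have h : f ⟨0, f.domain.zero_mem⟩ = 0 := f.map_zero
        rw [h]; exact g.domain.zero_mem⟩
      add_mem' := by
        rintro x y ⟨hx, hx'⟩ ⟨hy, hy'⟩
        refine ⟨f.domain.add_mem hx hy, ?_⟩
        have h : f ⟨x + y, f.domain.add_mem hx hy⟩ = f ⟨x, hx⟩ + f ⟨y, hy⟩ :=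
          f.map_add ⟨x, hx⟩ ⟨y, hy⟩
        rw [h]; exact g.domain.add_mem hx' hy'
      smul_mem' := by
        rintro c x ⟨hx, hx'⟩
        refine ⟨f.domain.smul_mem c hx, ?_⟩
        have h : f ⟨c • x, f.domain.smul_mem c hx⟩ = c • f ⟨x, hx⟩ := f.map_smul c ⟨x, hx⟩
        rw [h]; exact g.domain.smul_mem c hx' }
  toFun :=
    { toFun := fun x => g ⟨f ⟨x.1, x.2.1⟩, x.2.2⟩
      map_add' := by
        rintro ⟨x, hx, hx'⟩ ⟨y, hy, hy'⟩
        rw [← g.map_add]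
        congr 1
        exact Subtype.ext (f.map_add ⟨x, hx⟩ ⟨y, hy⟩)
      map_smul' := by
        rintro c ⟨x, hx, hx'⟩
        rw [RingHom.id_apply, ← g.map_smul]
        congr 1
        exact Subtype.ext (f.map_smul c ⟨x, hx⟩) }

end Comp

/-- The unbounded operator `t + c`, with domain `D(t)`. -/
def addScalar {E : Type*} [AddCommGroup E] [Module ℂ E] (t : E →ₗ.[ℂ] E) (c : ℂ) : E →ₗ.[ℂ] E :=
  (c • (LinearMap.id : E →ₗ[ℂ] E)) +ᵥ t

/-- The Cayley transform `C_t = (t - i)(t + i)⁻¹`. -/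
def cayley {E : Type*} [AddCommGroup E] [Module ℂ E] (t : E →ₗ.[ℂ] E) : E →ₗ.[ℂ] E :=
  pcomp (addScalar t (-Complex.I)) (addScalar t Complex.I).inverse

/-- An everywhere defined bounded operator, seen as a partially defined one. -/
def ofBounded {E : Type*} [NormedAddCommGroup E] [NormedSpace ℂ E] (T : E →L[ℂ] E) : E →ₗ.[ℂ] E :=
  (T : E →ₗ[ℂ] E).toPMap ⊤

section Module

variable (A : Type*) {E : Type*} [NonUnitalCStarAlgebra A] [PartialOrder A] [StarOrderedRing A]
  [NormedAddCommGroup E] [NormedSpace ℂ E] [SMul A E] [CStarModule A E]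

/-! ### Bounded adjointable operators and compact operators -/

/-- `T ∈ L(E)`: the bounded operator `T` has an adjoint for the `A`-valued inner product. -/
def IsAdjointable (T : E →L[ℂ] E) : Prop :=
  ∃ S : E →L[ℂ] E, ∀ x y : E, inner A (T x) y = inner A x (S y)

lemma ext_inner_aux {x y : E} (h : ∀ w : E, (inner A w x : A) = inner A w y) : x = y := by
  have h1 : (inner A (x - y) (x - y) : A) = 0 := by
    rw [CStarModule.inner_sub_right, h, sub_self]
  exact sub_eq_zero.1 (CStarModule.inner_self.1 h1)

lemma add_smul_aux (a b : A) (x : E) : (a + b) • x = a • x + b • x :=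
  ext_inner_aux A fun w => by simp [add_mul]

lemma smul_smul_aux (c : ℂ) (a : A) (x : E) : (c • a) • x = c • (a • x) :=
  ext_inner_aux A fun w => by simp [smul_mul_assoc]

lemma norm_smul_aux (a : A) (x : E) : ‖a • x‖ ≤ ‖a‖ * ‖x‖ := by
  have h1 : ‖a • x‖ ^ 2 = ‖(inner A (a • x) (a • x) : A)‖ := CStarModule.norm_sq_eq A
  have h2 : ‖x‖ ^ 2 = ‖(inner A x x : A)‖ := CStarModule.norm_sq_eq A
  have h3 : ‖a • x‖ ^ 2 ≤ (‖a‖ * ‖x‖) ^ 2 := by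
    rw [h1, CStarModule.inner_op_smul_right, CStarModule.inner_op_smul_left, mul_pow, h2]
    calc _ ≤ ‖a‖ * (‖(inner A x x : A)‖ * ‖star a‖) :=
          (norm_mul_le _ _).trans (by gcongr; exact norm_mul_le _ _)
      _ = _ := by rw [norm_star]; ring
  exact le_of_sq_le_sq h3 (by positivity)

/-- The elementary operator `θ_{x,y} : z ↦ ⟪y, z⟫ x`. -/
def theta (x y : E) : E →L[ℂ] E :=
  LinearMap.mkContinuous
    { toFun := fun z => (inner A y z : A) • x
      map_add' := fun z w => by
        rw [CStarModule.inner_add_right]; exact add_smul_aux A _ _ x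
      map_smul' := fun c z => by
        rw [CStarModule.inner_smul_right_complex, RingHom.id_apply]; exact smul_smul_aux A c _ x }
    (‖y‖ * ‖x‖) (fun z => by
      refine (norm_smul_aux A _ x).trans ?_
      have h : ‖(inner A y z : A)‖ ≤ ‖y‖ * ‖z‖ := CStarModule.norm_inner_le E
      nlinarith [norm_nonneg x])

variable (E) in
/-- `K(E)`: the norm closure of the linear span of the operators `θ_{x,y}`. -/
def compacts : Submodule ℂ (E →L[ℂ] E) :=
  (Submodule.span ℂ {T | ∃ x y : E, T = theta A x y}).topologicalClosure

/-- A bounded adjointable operator is Fredholm if it is invertible in `L(E)` modulo `K(E)`. -/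
def IsFredholmBounded (T : E →L[ℂ] E) : Prop :=
  IsAdjointable A T ∧ ∃ G : E →L[ℂ] E, IsAdjointable A G ∧
    G ∘L T - ContinuousLinearMap.id ℂ E ∈ compacts A E ∧
    T ∘L G - ContinuousLinearMap.id ℂ E ∈ compacts A E

/-! ### Regular operators -/

/-- The graph of the adjoint: all `(y, z)` with `⟪y, t x⟫ = ⟪z, x⟫` for every `x ∈ D(t)`. -/
def adjointGraph (t : E →ₗ.[ℂ] E) : Submodule ℂ (E × E) where
  carrier := {p | ∀ x : t.domain, inner A p.1 (t x) = inner A p.2 (x : E)}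
  zero_mem' := fun x => by simp
  add_mem' := fun {p q} hp hq x => by simp [hp x, hq x]
  smul_mem' := fun c p hp x => by simp [hp x]

/-- The adjoint `t*` of a densely defined operator (for dense `D(t)` the graph above is
single-valued). -/
def adjoint (t : E →ₗ.[ℂ] E) : E →ₗ.[ℂ] E := (adjointGraph A t).toLinearPMap

/-- Regular operators: closed densely defined `A`-linear operators with densely defined adjoint
such that `I + t*t` has dense range. -/
structure IsRegular (t : E →ₗ.[ℂ] E) : Prop where
  smul_mem : ∀ (a : A) (x : E), x ∈ t.domain → a • x ∈ t.domain
  map_smul : ∀ (a : A) (x : E) (hx : x ∈ t.domain),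
    t ⟨a • x, smul_mem a x hx⟩ = a • t ⟨x, hx⟩
  closed : t.IsClosed
  dense_domain : Dense (t.domain : Set E)
  dense_adjoint_domain : Dense ((adjoint A t).domain : Set E)
  dense_range : Dense (Set.range (addScalar (pcomp (adjoint A t) t) 1))

/-- `s` is closable, its closure belongs to `L(E)`, and this closure is `1` modulo `K(E)`. -/
def ClosureIsOneModCompacts (s : E →ₗ.[ℂ] E) : Prop :=
  s.IsClosable ∧ ∃ S : E →L[ℂ] E, IsAdjointable A S ∧ s.closure = ofBounded S ∧
    S - ContinuousLinearMap.id ℂ E ∈ compacts A E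

/-- `G ∈ L(E)` is a pseudo left inverse of `t`. -/
def IsPseudoLeftInverse (G : E →L[ℂ] E) (t : E →ₗ.[ℂ] E) : Prop :=
  IsAdjointable A G ∧ ClosureIsOneModCompacts A (pcomp (ofBounded G) t)

/-- `G ∈ L(E)` is a pseudo right inverse of `t`. -/
def IsPseudoRightInverse (G : E →L[ℂ] E) (t : E →ₗ.[ℂ] E) : Prop :=
  IsAdjointable A G ∧ ClosureIsOneModCompacts A (pcomp t (ofBounded G))

/-- A regular operator is Fredholm if it has a pseudo left and a pseudo right inverse. -/
def IsFredholm (t : E →ₗ.[ℂ] E) : Prop :=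
  (∃ G : E →L[ℂ] E, IsPseudoLeftInverse A G t) ∧ ∃ G : E →L[ℂ] E, IsPseudoRightInverse A G t

end Module

end

end HilbertModule

/-! Put `R = (t + i)⁻¹`. Since `(t - i)R = 1 - 2iR`, one has `1 + C_t = 2(1 - iR) = 2tR`, so it must
be shown that `t` is Fredholm iff the bounded operator `F = tR` is.

`exists_resolvent` produces `R`. For `c = ±i`, symmetry gives `⟪(t+c)x, (t+c)x⟫ = ⟪tx, tx⟫ + ⟪x,
x⟫`, so `t + c` is bounded below on the complete graph of `t` and has closed range. The range is
dense because `(t+c)(t-c) = t² + 1 = 1 + t*t`. The two resolvents are adjoint to each other.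

`isFredholm_iff_isFredholmBounded` compares `t` and `F`. An inverse `G` of `F` modulo compacts gives
pseudoinverses `GR` and `RG` of `t`; a one-sided pseudoinverse `G` of `t` gives the inverse `1 + cG`
of `F` on the same side. -/

namespace HilbertModule

open CStarModule

noncomputable section

set_option linter.unusedSectionVars false

/-! ### Closures that are everywhere defined bounded operators -/

section PartialMaps

variable {E : Type*} [NormedAddCommGroup E] [NormedSpace ℂ E]

/-- If `s` is contained in a bounded operator `S` and is densely defined, then `S` is its
closure. -/
lemma closure_eq_ofBounded {s : E →ₗ.[ℂ] E} {S : E →L[ℂ] E} (hd : Dense (s.domain : Set E))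
    (hs : ∀ x : s.domain, s x = S x) : s.IsClosable ∧ s.closure = ofBounded S := by
  have hcl : s.graph.topologicalClosure = (ofBounded S).graph := by
    apply le_antisymm
    · apply Submodule.topologicalClosure_minimal
      · rintro ⟨x, y⟩ hxy
        obtain ⟨z, rfl, rfl⟩ := (LinearPMap.mem_graph_iff _).1 hxy
        exact (LinearPMap.mem_graph_iff _).2 ⟨⟨z, trivial⟩, rfl, (hs z).symm⟩
      · have : ((ofBounded S).graph : Set (E × E)) = {p | S p.1 = p.2} := by
          ext ⟨x, y⟩
          refine (LinearPMap.mem_graph_iff _).trans ⟨?_, fun h => ⟨⟨x, trivial⟩, rfl, h⟩⟩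
          rintro ⟨z, rfl, h⟩
          exact h
        rw [this]
        exact isClosed_eq (by fun_prop) (by fun_prop)
    · rintro ⟨x, y⟩ hxy
      obtain ⟨⟨z, hz⟩, rfl, rfl⟩ := (LinearPMap.mem_graph_iff _).1 hxy
      have hc : Continuous fun x : E => (x, S x) := by fun_prop
      refine closure_mono ?_ (image_closure_subset_closure_image hc ⟨z, hd z, rfl⟩)
      rintro _ ⟨x, hx, rfl⟩
      exact (LinearPMap.mem_graph_iff _).2 ⟨⟨x, hx⟩, rfl, hs _⟩
  have h : s.IsClosable := ⟨_, hcl⟩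
  exact ⟨h, LinearPMap.eq_of_eq_graph (h.graph_closure_eq_closure_graph.symm.trans hcl)⟩

lemma eq_of_closure_eq_ofBounded {s : E →ₗ.[ℂ] E} {S : E →L[ℂ] E}
    (h : s.closure = ofBounded S) (x : s.domain) : s x = S x := by
  have := s.le_closure
  rw [h] at this
  exact this.2 (y := ⟨x, trivial⟩) rfl

/-- The graph of `s` is dense in that of `S`, and the latter projects onto `E`. -/
lemma dense_domain_of_closure_eq_ofBounded {s : E →ₗ.[ℂ] E} {S : E →L[ℂ] E}
    (hs : s.IsClosable) (h : s.closure = ofBounded S) : Dense (s.domain : Set E) := by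
  intro x
  have hx : (x, S x) ∈ s.graph.topologicalClosure := by
    rw [hs.graph_closure_eq_closure_graph, h]
    exact (LinearPMap.mem_graph_iff _).2 ⟨⟨x, trivial⟩, rfl, rfl⟩
  refine closure_mono ?_ (image_closure_subset_closure_image continuous_fst ⟨_, hx, rfl⟩)
  rintro _ ⟨⟨u, v⟩, huv, rfl⟩
  exact LinearPMap.mem_domain_of_mem_graph huv

end PartialMaps

/-! ### Adjointable operators and the ideal of compact operators -/

section Module

variable {A : Type*} {E : Type*} [NonUnitalCStarAlgebra A] [PartialOrder A] [StarOrderedRing A]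
  [NormedAddCommGroup E] [NormedSpace ℂ E] [SMul A E] [CStarModule A E]

namespace IsAdjointable

lemma id : IsAdjointable A (ContinuousLinearMap.id ℂ E) := ⟨.id ℂ E, fun _ _ => rfl⟩

lemma add {S T : E →L[ℂ] E} (hS : IsAdjointable A S) (hT : IsAdjointable A T) :
    IsAdjointable A (S + T) := by
  obtain ⟨S', hS⟩ := hS
  obtain ⟨T', hT⟩ := hT
  exact ⟨S' + T', fun x y => by simp [hS, hT]⟩

lemma smul (c : ℂ) {T : E →L[ℂ] E} (hT : IsAdjointable A T) : IsAdjointable A (c • T) := by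
  obtain ⟨T', hT⟩ := hT
  exact ⟨star c • T', fun x y => by simp [hT]⟩

lemma comp {S T : E →L[ℂ] E} (hS : IsAdjointable A S) (hT : IsAdjointable A T) :
    IsAdjointable A (S ∘L T) := by
  obtain ⟨S', hS⟩ := hS
  obtain ⟨T', hT⟩ := hT
  exact ⟨T' ∘L S', fun x y => by simp [hS, hT]⟩

lemma map_smul {T : E →L[ℂ] E} (hT : IsAdjointable A T) (a : A) (x : E) :
    T (a • x) = a • T x := by
  obtain ⟨T', hT⟩ := hT
  have hT' : ∀ w y : E, (inner A w (T y) : A) = inner A (T' w) y := fun w y => by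
    rw [← star_inner, hT, star_inner]
  exact ext_inner_aux A fun w => by simp [hT']

end IsAdjointable

/-- `T θ_{x,y} = θ_{Tx,y}` by `A`-linearity of `T`; extend by linearity and continuity. -/
lemma comp_mem_compacts {T K : E →L[ℂ] E} (hT : IsAdjointable A T) (hK : K ∈ compacts A E) :
    T ∘L K ∈ compacts A E := by
  have hc : Continuous fun S : E →L[ℂ] E => T ∘L S := by fun_prop
  refine map_mem_closure hc hK fun S hS => ?_
  induction hS using Submodule.span_induction with
  | mem S hS =>
    obtain ⟨x, y, rfl⟩ := hS
    exact Submodule.subset_span ⟨T x, y, by ext z; exact hT.map_smul _ _⟩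
  | zero => simp
  | add S S' _ _ h h' => simpa using add_mem h h'
  | smul c S _ h => simpa using Submodule.smul_mem _ c h

/-- `θ_{x,y} T = θ_{x,T*y}`; extend as before. -/
lemma mem_compacts_comp {T K : E →L[ℂ] E} (hT : IsAdjointable A T) (hK : K ∈ compacts A E) :
    K ∘L T ∈ compacts A E := by
  obtain ⟨T', hT⟩ := hT
  have hT' : ∀ w y : E, (inner A w (T y) : A) = inner A (T' w) y := fun w y => by
    rw [← star_inner, hT, star_inner]
  have hc : Continuous fun S : E →L[ℂ] E => S ∘L T := by fun_prop
  refine map_mem_closure (f := fun S : E →L[ℂ] E => S ∘L T) hc hK fun S hS => ?_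
  induction hS using Submodule.span_induction with
  | mem S hS =>
    obtain ⟨x, y, rfl⟩ := hS
    exact Submodule.subset_span ⟨x, T' y, by
      ext z; exact congrArg (fun a : A => a • x) (hT' y z)⟩
  | zero => simp
  | add S S' _ _ h h' => simpa using add_mem h h'
  | smul c S _ h => simpa using Submodule.smul_mem _ c h

/-- A left and a right inverse modulo `K(E)` give a two-sided one. -/
lemma isFredholmBounded_of_left_right {T G H : E →L[ℂ] E} (hT : IsAdjointable A T)
    (hG : IsAdjointable A G) (hH : IsAdjointable A H)
    (hGT : G ∘L T - .id ℂ E ∈ compacts A E) (hTH : T ∘L H - .id ℂ E ∈ compacts A E) :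
    IsFredholmBounded A T := by
  refine ⟨hT, G, hG, hGT, ?_⟩
  have h1 := comp_mem_compacts hT (mem_compacts_comp hH hGT)
  have h2 := comp_mem_compacts hT (comp_mem_compacts hG hTH)
  -- Modulo compacts, `TG = TG(TH) = T(GT)H = TH = 1`, with the error terms kept.
  have h3 : T ∘L G - .id ℂ E = (T ∘L H - .id ℂ E) + T ∘L (G ∘L T - .id ℂ E) ∘L H
      - T ∘L G ∘L (T ∘L H - .id ℂ E) := by
    ext x; simp
  rw [h3]
  exact sub_mem (add_mem hTH h1) h2

lemma isFredholmBounded_smul_iff {T : E →L[ℂ] E} {c : ℂ} (hc : c ≠ 0) :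
    IsFredholmBounded A (c • T) ↔ IsFredholmBounded A T := by
  have key : ∀ (d : ℂ) (S : E →L[ℂ] E), d ≠ 0 → IsFredholmBounded A S →
      IsFredholmBounded A (d • S) := by
    rintro d S hd ⟨hS, G, hG, h1, h2⟩
    refine ⟨hS.smul d, d⁻¹ • G, hG.smul _, ?_, ?_⟩
    · simpa [smul_smul, hd] using h1
    · simpa [smul_smul, hd] using h2
  refine ⟨fun h => ?_, key c T hc⟩
  simpa [smul_smul, hc] using key c⁻¹ _ (inv_ne_zero hc) h

/-! ### Resolvents of selfadjoint regular operators -/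

/-- The inner product separates the points of `E` already on a dense subspace. -/
lemma eq_zero_of_inner_eq_zero_of_dense {D : Set E} (hD : Dense D) {z : E}
    (h : ∀ x ∈ D, (inner A z x : A) = 0) : z = 0 := by
  have hc : Continuous fun x : E => (inner A z x : A) :=
    (continuous_inner (A := A) (E := E)).comp (by fun_prop : Continuous fun x : E => (z, x))
  exact CStarModule.inner_self.1
    (congrFun (hc.ext_on hD continuous_const h) z)

lemma inner_adjoint_left {t : E →ₗ.[ℂ] E} (hd : Dense (t.domain : Set E))
    (y : (adjoint A t).domain) (x : t.domain) :
    (inner A (y : E) (t x) : A) = inner A (adjoint A t y) (x : E) := by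
  have hg : (adjoint A t).graph = adjointGraph A t := by
    refine Submodule.toLinearPMap_graph_eq _ ?_
    rintro ⟨u, v⟩ huv (rfl : u = 0)
    refine eq_zero_of_inner_eq_zero_of_dense (A := A) hd fun x hx => ?_
    simpa using (huv ⟨x, hx⟩).symm
  have h := (adjoint A t).mem_graph y
  rw [hg] at h
  exact h x

lemma inner_symm_of_adjoint_eq {t : E →ₗ.[ℂ] E} (hd : Dense (t.domain : Set E))
    (hsa : adjoint A t = t) (x y : t.domain) :
    (inner A (x : E) (t y) : A) = inner A (t x) (y : E) := by
  have h := inner_adjoint_left (A := A) hd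
  rw [hsa] at h
  exact h x y

/-- The cross terms cancel because `c` is imaginary and `t` is symmetric. -/
lemma inner_add_smul_self {t : E →ₗ.[ℂ] E}
    (hsym : ∀ x y : t.domain, (inner A (x : E) (t y) : A) = inner A (t x) (y : E))
    {c : ℂ} (hc : star c = -c) (hc2 : c * c = -1) (x : t.domain) :
    (inner A (t x + c • (x : E)) (t x + c • (x : E)) : A)
      = inner A (t x) (t x) + inner A (x : E) (x : E) := by
  simp only [CStarModule.inner_add_right, CStarModule.inner_add_left, inner_smul_right_complex,
    inner_smul_left_complex, smul_add, hc, hsym, neg_smul, smul_neg, smul_smul, hc2,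
    neg_neg, one_smul]
  abel

lemma norm_le_of_inner_eq_add {x y z : E}
    (h : (inner A z z : A) = inner A x x + inner A y y) : ‖x‖ ≤ ‖z‖ := by
  refine le_of_sq_le_sq ?_ (norm_nonneg z)
  rw [norm_sq_eq A, norm_sq_eq A (x := z), h]
  exact CStarAlgebra.norm_le_norm_of_nonneg_of_le inner_self_nonneg
    (le_add_of_nonneg_right inner_self_nonneg)

/-- The resolvent of a selfadjoint regular operator at `-c`, for `c = ± i`. -/
lemma exists_resolvent [CompleteSpace E] {t : E →ₗ.[ℂ] E} (ht : IsRegular A t)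
    (hsa : adjoint A t = t) {c : ℂ} (hc : star c = -c) (hc2 : c * c = -1) :
    ∃ R : E →L[ℂ] E, (∀ y, ∃ h : R y ∈ t.domain, t ⟨R y, h⟩ + c • R y = y) ∧
      ∀ x : t.domain, R (t x + c • (x : E)) = x := by
  have hsym := inner_symm_of_adjoint_eq (A := A) ht.dense_domain hsa
  have hin := inner_add_smul_self hsym hc hc2
  -- `t + c` as a bounded operator on the graph, which is complete because `t` is closed.
  let g : t.graph →L[ℂ] E :=
    (ContinuousLinearMap.snd ℂ E E + c • ContinuousLinearMap.fst ℂ E E) ∘L t.graph.subtypeL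
  have hbound : ∀ p : t.graph, ‖p‖ ≤ ‖g p‖ := by
    rintro ⟨⟨u, v⟩, huv⟩
    obtain ⟨x, rfl, rfl⟩ := (LinearPMap.mem_graph_iff _).1 huv
    exact max_le (norm_le_of_inner_eq_add ((hin x).trans (add_comm _ _)))
      (norm_le_of_inner_eq_add (hin x))
  have hanti : AntilipschitzWith 1 g :=
    AddMonoidHomClass.antilipschitz_of_bound g fun p => by simpa using hbound p
  have : CompleteSpace t.graph := ht.closed.completeSpace_coe
  have hclosed : IsClosed (Set.range g) := hanti.isClosed_range g.uniformContinuous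
  have hdense : Dense (Set.range g) := by
    refine ht.dense_range.mono ?_
    rw [hsa]
    rintro _ ⟨⟨x, hx, hx'⟩, rfl⟩
    -- `(t + c)` applied to `(t - c)x` is `t²x + x`, as `c² = -1`.
    have hmem : t ⟨x, hx⟩ + (-c) • x ∈ t.domain := t.domain.add_mem hx' (t.domain.smul_mem _ hx)
    refine ⟨⟨_, t.mem_graph ⟨_, hmem⟩⟩, ?_⟩
    have e : t ⟨_, hmem⟩ = t ⟨t ⟨x, hx⟩, hx'⟩ + (-c) • t ⟨x, hx⟩ := by
      rw [← t.map_smul, ← t.map_add]; rfl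
    change t ⟨_, hmem⟩ + c • (t ⟨x, hx⟩ + (-c) • x) = (1 : ℂ) • x + t ⟨t ⟨x, hx⟩, hx'⟩
    rw [e, smul_add, smul_smul, mul_neg, hc2, neg_neg]
    module
  have hsurj : Function.Surjective g := by
    rw [← Set.range_eq_univ, ← hclosed.closure_eq, hdense.closure_eq]
  let e : t.graph ≃ₗ[ℂ] E := LinearEquiv.ofBijective g.toLinearMap ⟨hanti.injective, hsurj⟩
  have he : ∀ p, e p = g p := fun _ => rfl
  let R₀ : E →L[ℂ] t.graph := LinearMap.mkContinuous e.symm.toLinearMap 1 fun y => by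
    simpa [← he] using hbound (e.symm y)
  refine ⟨ContinuousLinearMap.fst ℂ E E ∘L t.graph.subtypeL ∘L R₀, fun y => ?_, fun x => ?_⟩
  · obtain ⟨x, hx, hx'⟩ := (LinearPMap.mem_graph_iff _).1 (R₀ y).2
    have hy : (R₀ y).1.2 + c • (R₀ y).1.1 = y := e.apply_symm_apply y
    have hmem : (R₀ y).1.1 ∈ t.domain := hx ▸ x.2
    have hval : t ⟨(R₀ y).1.1, hmem⟩ = (R₀ y).1.2 :=
      (congrArg t (Subtype.ext hx.symm)).trans hx'
    exact ⟨hmem, (congrArg (· + c • (R₀ y).1.1) hval).trans hy⟩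
  · have : R₀ (t x + c • (x : E)) = ⟨_, t.mem_graph x⟩ := e.symm_apply_apply ⟨_, t.mem_graph x⟩
    change (R₀ (t x + c • (x : E))).1.1 = _
    rw [this]

/-- Resolvents at conjugate points are adjoint to each other. -/
lemma isAdjointable_resolvent {t : E →ₗ.[ℂ] E}
    (hsym : ∀ x y : t.domain, (inner A (x : E) (t y) : A) = inner A (t x) (y : E))
    {c : ℂ} {R R' : E →L[ℂ] E}
    (hR : ∀ y, ∃ h : R y ∈ t.domain, t ⟨R y, h⟩ + c • R y = y)
    (hR' : ∀ y, ∃ h : R' y ∈ t.domain, t ⟨R' y, h⟩ + star c • R' y = y) :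
    IsAdjointable A R := by
  refine ⟨R', fun x y => ?_⟩
  obtain ⟨h, hx⟩ := hR x
  obtain ⟨h', hy⟩ := hR' y
  have hs := hsym ⟨_, h⟩ ⟨_, h'⟩
  conv_lhs => rw [← hy]
  conv_rhs => rw [← hx]
  simp only [CStarModule.inner_add_right, CStarModule.inner_add_left, inner_smul_right_complex,
    inner_smul_left_complex, hs]

/-! ### Passing between `t` and `tR` -/

lemma isPseudoLeftInverse_of_comp {t : E →ₗ.[ℂ] E} (hd : Dense (t.domain : Set E))
    {F R G : E →L[ℂ] E} (hR : IsAdjointable A R) (hF : IsAdjointable A F) (hG : IsAdjointable A G)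
    (hRt : ∀ x : t.domain, R (t x) = F x) (hGF : G ∘L F - .id ℂ E ∈ compacts A E) :
    IsPseudoLeftInverse A (G ∘L R) t := by
  refine ⟨hG.comp hR, ?_⟩
  obtain ⟨h1, h2⟩ := closure_eq_ofBounded (s := pcomp (ofBounded (G ∘L R)) t) (S := G ∘L F)
    (hd.mono fun x hx => ⟨hx, trivial⟩) fun x => congrArg G (hRt ⟨x.1, x.2.1⟩)
  exact ⟨h1, _, hG.comp hF, h2, hGF⟩

lemma isPseudoRightInverse_of_comp {t : E →ₗ.[ℂ] E}
    {F R G : E →L[ℂ] E} (hR : IsAdjointable A R) (hF : IsAdjointable A F) (hG : IsAdjointable A G)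
    (htR : ∀ y, ∃ h : R y ∈ t.domain, t ⟨R y, h⟩ = F y)
    (hFG : F ∘L G - .id ℂ E ∈ compacts A E) :
    IsPseudoRightInverse A (R ∘L G) t := by
  refine ⟨hR.comp hG, ?_⟩
  obtain ⟨h1, h2⟩ := closure_eq_ofBounded (s := pcomp t (ofBounded (R ∘L G))) (S := F ∘L G)
    (dense_univ.mono fun x _ => ⟨trivial, (htR (G x)).1⟩) fun x => (htR (G x)).2
  exact ⟨h1, _, hF.comp hG, h2, hFG⟩

/-- An operator `t` with bounded adjointable resolvent `R = (t + c)⁻¹` is Fredholm iff `t R` is. -/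
lemma isFredholm_iff_isFredholmBounded {t : E →ₗ.[ℂ] E} (hd : Dense (t.domain : Set E))
    {c : ℂ} {R : E →L[ℂ] E} (hR : IsAdjointable A R)
    (hR1 : ∀ y, ∃ h : R y ∈ t.domain, t ⟨R y, h⟩ + c • R y = y)
    (hR2 : ∀ x : t.domain, R (t x + c • (x : E)) = x) :
    IsFredholm A t ↔ IsFredholmBounded A (ContinuousLinearMap.id ℂ E + (-c) • R) := by
  set F : E →L[ℂ] E := ContinuousLinearMap.id ℂ E + (-c) • R with hFdef
  have hF : IsAdjointable A F := IsAdjointable.id.add (hR.smul _)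
  have hFx : ∀ x, F x = x - c • R x := fun x => by simp [hFdef, sub_eq_add_neg]
  have htR : ∀ y, ∃ h : R y ∈ t.domain, t ⟨R y, h⟩ = F y := fun y => by
    obtain ⟨h, hy⟩ := hR1 y
    exact ⟨h, by rw [hFx, eq_sub_iff_add_eq, hy]⟩
  have hRt : ∀ x : t.domain, R (t x) = F x := fun x => by
    have := hR2 x
    rw [map_add, map_smul] at this
    rw [hFx, eq_sub_iff_add_eq, this]
  constructor
  · rintro ⟨⟨G, hG, hcl, S, hS, hSc, hSK⟩, H, hH, hcl', S', hS', hSc', hSK'⟩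
    -- As `F = 1 - cR` and `GF = GtR = SR`, one gets `(1 + cG)F - 1 = c(S - 1)R`; similarly on the
    -- right.
    refine isFredholmBounded_of_left_right hF (IsAdjointable.id.add (hG.smul c))
      (IsAdjointable.id.add (hH.smul c)) ?_ ?_
    · have h1 : ∀ x, G (F x) = S (R x) := fun x => by
        obtain ⟨h, hx⟩ := htR x
        rw [← hx]
        exact eq_of_closure_eq_ofBounded hSc ⟨R x, h, trivial⟩
      have h2 : (ContinuousLinearMap.id ℂ E + c • G) ∘L F - .id ℂ E
          = c • ((S - .id ℂ E) ∘L R) := by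
        ext x
        simp only [_root_.sub_apply, ContinuousLinearMap.comp_apply,
          _root_.add_apply, _root_.smul_apply,
          ContinuousLinearMap.id_apply, h1]
        rw [hFx]
        module
      rw [h2]
      exact Submodule.smul_mem _ _ (mem_compacts_comp hR hSK)
    · have h1 : ∀ x, F (H x) = R (S' x) := by
        -- `FH = RtH = RS'` is clear only where `Hx ∈ D(t)`; such `x` are dense.
        have hdd := dense_domain_of_closure_eq_ofBounded hcl' hSc'
        refine congrFun (Continuous.ext_on hdd (by fun_prop) (by fun_prop) fun x hx => ?_)
        have := eq_of_closure_eq_ofBounded hSc' ⟨x, hx⟩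
        rw [← this]
        exact (hRt ⟨H x, hx.2⟩).symm
      have h2 : F ∘L (ContinuousLinearMap.id ℂ E + c • H) - .id ℂ E
          = c • (R ∘L (S' - .id ℂ E)) := by
        ext x
        simp only [_root_.sub_apply, ContinuousLinearMap.comp_apply,
          _root_.add_apply, _root_.smul_apply,
          ContinuousLinearMap.id_apply, map_add, map_smul, map_sub, h1]
        rw [hFx]
        module
      rw [h2]
      exact Submodule.smul_mem _ _ (comp_mem_compacts hR hSK')
  · rintro ⟨-, G, hG, hGF, hFG⟩
    exact ⟨⟨_, isPseudoLeftInverse_of_comp hd hR hF hG hRt hGF⟩,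
      ⟨_, isPseudoRightInverse_of_comp hR hF hG htR hFG⟩⟩

end Module

/-! ### The Cayley transform in terms of the resolvent -/

section Cayley

variable {E : Type*} [NormedAddCommGroup E] [NormedSpace ℂ E]

lemma addScalar_apply (t : E →ₗ.[ℂ] E) (c : ℂ) (x : t.domain) :
    addScalar t c x = t x + c • (x : E) :=
  add_comm (c • (x : E)) (t x)

lemma bijective_addScalar {t : E →ₗ.[ℂ] E} {c : ℂ} {R : E →L[ℂ] E}
    (hR1 : ∀ y, ∃ h : R y ∈ t.domain, t ⟨R y, h⟩ + c • R y = y)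
    (hR2 : ∀ x : t.domain, R (t x + c • (x : E)) = x) :
    Function.Bijective (addScalar t c) := by
  constructor
  · intro x y hxy
    have h : ∀ x : t.domain, R (addScalar t c x) = x := fun x =>
      (congrArg R (addScalar_apply t c x)).trans (hR2 x)
    exact Subtype.ext ((h x).symm.trans ((congrArg R hxy).trans (h y)))
  · intro y
    obtain ⟨h, hy⟩ := hR1 y
    exact ⟨⟨R y, h⟩, (addScalar_apply t c ⟨R y, h⟩).trans hy⟩

lemma cayley_eq_ofBounded {t : E →ₗ.[ℂ] E} {R : E →L[ℂ] E}
    (hR1 : ∀ y, ∃ h : R y ∈ t.domain, t ⟨R y, h⟩ + Complex.I • R y = y)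
    (hR2 : ∀ x : t.domain, R (t x + Complex.I • (x : E)) = x) :
    cayley t = ofBounded (ContinuousLinearMap.id ℂ E + (-2 * Complex.I) • R) := by
  have hbij := bijective_addScalar hR1 hR2
  have hker : LinearMap.ker (addScalar t Complex.I).toFun = ⊥ := LinearMap.ker_eq_bot.2 hbij.1
  have hdom : ∀ y, y ∈ (addScalar t Complex.I).inverse.domain := fun y => by
    rw [LinearPMap.inverse_domain]; exact hbij.2 y
  have hinv : ∀ y (hy : y ∈ (addScalar t Complex.I).inverse.domain),
      (addScalar t Complex.I).inverse ⟨y, hy⟩ = R y := fun y hy => by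
    obtain ⟨h, hy'⟩ := hR1 y
    exact LinearPMap.inverse_apply_eq hker (x := ⟨R y, h⟩)
      ((addScalar_apply t Complex.I ⟨R y, h⟩).trans hy')
  have hmem : ∀ y, (addScalar t Complex.I).inverse ⟨y, hdom y⟩ ∈ t.domain := fun y => by
    rw [hinv]; exact (hR1 y).1
  refine LinearPMap.ext (SetLike.ext fun y => ⟨fun _ => trivial, fun _ => ⟨hdom y, hmem y⟩⟩) ?_
  intro y hy _
  obtain ⟨h, hy'⟩ := hR1 y
  have h1 : cayley t ⟨y, hy⟩ = addScalar t (-Complex.I) ⟨R y, h⟩ :=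
    congrArg (addScalar t (-Complex.I)) (Subtype.ext (hinv y _))
  have h2 : t ⟨R y, h⟩ = y - Complex.I • R y := eq_sub_of_add_eq hy'
  refine (h1.trans (addScalar_apply t _ ⟨R y, h⟩)).trans ?_
  change t ⟨R y, h⟩ + (-Complex.I) • R y = y + (-2 * Complex.I) • R y
  rw [h2]
  module

end Cayley

end

end HilbertModule

open HilbertModule

theorem mainTheorem2 {A E : Type*} [NonUnitalCStarAlgebra A] [PartialOrder A] [StarOrderedRing A]
    [NormedAddCommGroup E] [NormedSpace ℂ E] [SMul A E] [CStarModule A E] [CompleteSpace E]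
    (t : E →ₗ.[ℂ] E) (ht : HilbertModule.IsRegular A t)
    (hsa : HilbertModule.adjoint A t = t) :
    Function.Bijective (HilbertModule.addScalar t Complex.I) ∧
    ∃ C : E →L[ℂ] E, HilbertModule.cayley t = HilbertModule.ofBounded C ∧
      HilbertModule.IsAdjointable A C ∧
      (HilbertModule.IsFredholm A t ↔
        HilbertModule.IsFredholmBounded A (ContinuousLinearMap.id ℂ E + C)) := by
  have hsym := inner_symm_of_adjoint_eq (A := A) ht.dense_domain hsa
  obtain ⟨R, hR1, hR2⟩ := exists_resolvent ht hsa (c := Complex.I) (by simp) (by simp)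
  -- The resolvent at the conjugate point serves as the adjoint of `R`.
  obtain ⟨R', hR1', -⟩ := exists_resolvent ht hsa (c := star Complex.I) (by simp) (by simp)
  have hR : IsAdjointable A R := isAdjointable_resolvent hsym hR1 hR1'
  refine ⟨bijective_addScalar hR1 hR2, _, cayley_eq_ofBounded hR1 hR2,
    IsAdjointable.id.add (hR.smul _), ?_⟩
  have h : ContinuousLinearMap.id ℂ E + (ContinuousLinearMap.id ℂ E + (-2 * Complex.I) • R)
      = (2 : ℂ) • (ContinuousLinearMap.id ℂ E + (-Complex.I) • R) := by
    module
  rw [h, isFredholmBounded_smul_iff two_ne_zero]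
  exact isFredholm_iff_isFredholmBounded ht.dense_domain hR hR1 hR2
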